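/- Let $M_2$ be the algebra of complex $2\times 2$ matrices. A density matrix is a positive semidefinite complex matrix of trace one; a density matrix on a tensor product $\mathbb C^n\otimes\mathbb C^2$ is separable if it is a convex combination of matrices $A\otimes B$ with $A$ and $B$ density matrices on $\mathbb C^n$ and $\mathbb C^2$. A linear map $\Phi:M_2\to M_2$ is entanglement breaking if for every $n$ and every density matrix $\Gamma$ on $\mathbb C^n\otimes\mathbb C^2$ the matrix $(I\otimes\Phi)(\Gamma)$ is separable (such a map is automatically completely positive). Let $\mathrm{EBT}$ be the set of all entanglement-breaking trace-preserving linear maps $M_2\to M_2$. A linear map $\Phi:M_2\to M_2$ is a qubit classical-quantum (CQ) map if there are an orthonormal basis $e_1,e_2$ of $\mathbb C^2$ and density matrices $R_1,R_2\in M_2$ with $$\Phi(\rho)=\sum_{k=1}^{2}\operatorname{Tr}\big(|e_k\rangle\langle e_k|\,\rho\big)\,R_k\qquad\text{for all }\rho\in M_2 .$$ Theorem. Every extreme point of $\mathrm{EBT}$ is a CQ map. Moreover, $\mathrm{EBT}$ is equal to the convex hull of the set of qubit CQ maps. -/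

import Mathlib

open scoped ComplexOrder Kronecker

namespace Qubit

/-- A density matrix: positive semidefinite with trace one. -/
def IsDensityMatrix {ι : Type*} [Fintype ι] (ρ : Matrix ι ι ℂ) : Prop :=
  ρ.PosSemidef ∧ ρ.trace = 1

/-- A state on a tensor product is separable if it is a convex combination of product states. -/
def IsSeparable {ι κ : Type*} [Fintype ι] [Fintype κ] (Γ : Matrix (ι × κ) (ι × κ) ℂ) : Prop :=
  Γ ∈ convexHull ℝ {P : Matrix (ι × κ) (ι × κ) ℂ |
    ∃ (A : Matrix ι ι ℂ) (B : Matrix κ κ ℂ), IsDensityMatrix A ∧ IsDensityMatrix B ∧ P = A ⊗ₖ B}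

/-- The action of `id ⊗ Φ` on matrices over `ι × κ`: `Φ` is applied to every block. -/
def idTensor (ι : Type*) {κ : Type*}
    (Φ : Matrix κ κ ℂ →ₗ[ℂ] Matrix κ κ ℂ) (Γ : Matrix (ι × κ) (ι × κ) ℂ) :
    Matrix (ι × κ) (ι × κ) ℂ :=
  Matrix.of fun p q => Φ (Matrix.of fun a b => Γ (p.1, a) (q.1, b)) p.2 q.2

/-- `Φ` is trace-preserving. -/
def IsTracePreserving {κ : Type*} [Fintype κ] (Φ : Matrix κ κ ℂ →ₗ[ℂ] Matrix κ κ ℂ) : Prop :=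
  ∀ ρ, (Φ ρ).trace = ρ.trace

/-- `Φ` is entanglement breaking: `(id ⊗ Φ)(Γ)` is separable for every density matrix `Γ` on a
tensor product of `Φ`'s space with an arbitrary finite-dimensional space. Separable matrices being
positive semidefinite, this includes complete positivity of `Φ`. -/
def IsEntanglementBreaking {κ : Type*} [Fintype κ]
    (Φ : Matrix κ κ ℂ →ₗ[ℂ] Matrix κ κ ℂ) : Prop :=
  ∀ (n : ℕ) (Γ : Matrix (Fin n × κ) (Fin n × κ) ℂ),
    IsDensityMatrix Γ → IsSeparable (idTensor (Fin n) Φ Γ)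

/-- The set of entanglement-breaking trace-preserving maps on `d × d` complex matrices. -/
def EBT (d : ℕ) : Set (Matrix (Fin d) (Fin d) ℂ →ₗ[ℂ] Matrix (Fin d) (Fin d) ℂ) :=
  {Φ | IsTracePreserving Φ ∧ IsEntanglementBreaking Φ}

/-- The set of classical-quantum maps on `d × d` complex matrices:
`Φ(ρ) = ∑ₖ Tr(|eₖ⟩⟨eₖ| ρ) Rₖ` with `e` an orthonormal basis and every `Rₖ` a density matrix. -/
def CQ (d : ℕ) : Set (Matrix (Fin d) (Fin d) ℂ →ₗ[ℂ] Matrix (Fin d) (Fin d) ℂ) :=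
  {Φ | ∃ (e : OrthonormalBasis (Fin d) ℂ (EuclideanSpace ℂ (Fin d)))
      (R : Fin d → Matrix (Fin d) (Fin d) ℂ),
      (∀ k, IsDensityMatrix (R k)) ∧
      ∀ ρ, Φ ρ = ∑ k, (Matrix.vecMulVec (e k).ofLp (star (e k).ofLp) * ρ).trace • R k}

end Qubit

namespace Qubit

open Matrix

open scoped InnerProductSpace

/-! Applying an entanglement-breaking map to half of a maximally entangled state gives the Holevo
form `Φ(ρ) = ∑ Tr(F_k ρ) R_k` with `F_k ≥ 0` and `∑ F_k = 1` (`exists_measurePrepare_of_mem_EBT`).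
By Hahn-Banach it is enough that every real functional `f` is at least as large on some CQ map as on
`Φ`. With `R_k` of Bloch vector `r_k`, `2 f(Φ) = ∑ (t(F_k) + ⟪v(F_k), r_k⟫)` for real-linear `t`,
`v`. The first part is always `t(1)`; the second is at most `∑ ‖v(F_k)‖`. The crux,
`sum_norm_le_of_projections`, bounds this by the maximum of `‖v(P)‖ + ‖v(1 - P)‖` over rank-one
projections `P`, which a CQ map measuring `P` attains. -/

/-- In finite dimension, the convex hull of a compact set is compact (by Carathéodory). -/
theorem isCompact_convexHull {E : Type*} [AddCommGroup E] [Module ℝ E] [TopologicalSpace E]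
    [IsTopologicalAddGroup E] [ContinuousSMul ℝ E] [FiniteDimensional ℝ E] {s : Set E}
    (hs : IsCompact s) : IsCompact (convexHull ℝ s) := by
  -- Carathéodory needs at most `finrank + 1` points, hence `range (finrank + 2)`; each piece is a
  -- continuous image of a compact set.
  have key : convexHull ℝ s = ⋃ n ∈ Finset.range (Module.finrank ℝ E + 2),
      (fun p : (Fin n → ℝ) × (Fin n → E) => ∑ i, p.1 i • p.2 i) ''
        (stdSimplex ℝ (Fin n) ×ˢ Set.univ.pi fun _ => s) := by
    apply Set.Subset.antisymm
    · intro x hx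
      obtain ⟨ι, _, z, w, hz, hi, hw, hw1, rfl⟩ := eq_pos_convex_span_of_mem_convexHull hx
      have hcard := hi.card_le_finrank_succ
      have hle := Submodule.finrank_le (vectorSpan ℝ (Set.range z))
      simp only [Set.mem_iUnion]
      let e := Fintype.equivFin ι
      refine ⟨Fintype.card ι, Finset.mem_range.2 (by omega), (w ∘ e.symm, z ∘ e.symm),
        ⟨⟨fun i => (hw _).le, ?_⟩, fun i _ => hz ⟨_, rfl⟩⟩, ?_⟩
      · simpa using (e.symm.sum_comp w).trans hw1
      · exact e.symm.sum_comp fun i => w i • z i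
    · refine Set.iUnion₂_subset fun n _ => ?_
      rintro _ ⟨⟨w, z⟩, ⟨hw, hz⟩, rfl⟩
      exact mem_convexHull_of_exists_fintype w z hw.1 hw.2 (fun i => hz i trivial) rfl
  rw [key]
  refine (Finset.range _).isCompact_biUnion fun n _ => ?_
  refine ((isCompact_stdSimplex ℝ (Fin n)).prod (isCompact_univ_pi fun _ => hs)).image ?_
  fun_prop

/-! ### Measure-and-prepare maps and the Holevo form -/

/-- The rank-one matrices of an orthonormal basis sum to the identity. -/
theorem sum_vecMulVec_orthonormalBasis {ι : Type*} [Fintype ι] [DecidableEq ι]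
    (e : OrthonormalBasis ι ℂ (EuclideanSpace ℂ ι)) :
    ∑ k, vecMulVec (e k).ofLp (star (e k).ofLp) = 1 := by
  ext i j
  have h := e.sum_inner_mul_inner (EuclideanSpace.single i 1) (EuclideanSpace.single j 1)
  rw [Matrix.sum_apply, Matrix.one_apply]
  simp only [EuclideanSpace.inner_single_left, EuclideanSpace.inner_single_right] at h
  simpa [vecMulVec_apply, Pi.single_apply, eq_comm (a := j)] using h

/-- The map `ρ ↦ Tr(F ρ) R`, as a bilinear function of `F` and `R`. -/
def measurePrepare (κ : Type*) [Fintype κ] :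
    Matrix κ κ ℂ →ₗ[ℂ] Matrix κ κ ℂ →ₗ[ℂ] Matrix κ κ ℂ →ₗ[ℂ] Matrix κ κ ℂ :=
  LinearMap.mk₂ ℂ
    (fun F R => ((traceLinearMap κ ℂ ℂ) ∘ₗ (LinearMap.mulLeft ℂ F)).smulRight R)
    (fun F F' R => by ext1 ρ; simp [add_mul, add_smul])
    (fun c F R => by ext1 ρ; simp [smul_smul])
    (fun F R R' => by ext1 ρ; simp)
    (fun c F R => by ext1 ρ; simp [smul_smul, mul_comm])

@[simp]
theorem measurePrepare_apply {κ : Type*} [Fintype κ] (F R ρ : Matrix κ κ ℂ) :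
    measurePrepare κ F R ρ = (F * ρ).trace • R := rfl

theorem idTensor_add {ι κ : Type*} (Φ Ψ : Matrix κ κ ℂ →ₗ[ℂ] Matrix κ κ ℂ)
    (Γ : Matrix (ι × κ) (ι × κ) ℂ) :
    idTensor ι (Φ + Ψ) Γ = idTensor ι Φ Γ + idTensor ι Ψ Γ := rfl

theorem idTensor_smul {ι κ : Type*} (c : ℝ) (Φ : Matrix κ κ ℂ →ₗ[ℂ] Matrix κ κ ℂ)
    (Γ : Matrix (ι × κ) (ι × κ) ℂ) : idTensor ι (c • Φ) Γ = c • idTensor ι Φ Γ := rfl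

theorem convex_EBT (d : ℕ) : Convex ℝ (EBT d) := by
  rintro Φ ⟨hΦ, hΦ'⟩ Ψ ⟨hΨ, hΨ'⟩ a b ha hb hab
  refine ⟨fun ρ => ?_, fun n Γ hΓ => ?_⟩
  · simp only [LinearMap.add_apply, LinearMap.smul_apply, trace_add, trace_smul, hΦ ρ, hΨ ρ]
    rw [← add_smul, hab, one_smul]
  · rw [idTensor_add, idTensor_smul, idTensor_smul]
    exact convex_convexHull ℝ _ (hΦ' n Γ hΓ) (hΨ' n Γ hΓ) ha hb hab

/-- Measuring `e k` on the second factor leaves the unnormalised state `A k` on the first, so the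
output is `∑ A k ⊗ₖ R k`; the traces of the `A k` become the convex weights. -/
theorem CQ_subset_EBT (d : ℕ) : CQ d ⊆ EBT d := by
  rintro Φ ⟨e, R, hR, hΦ⟩
  constructor
  · intro ρ
    simp only [hΦ, trace_sum, trace_smul, (hR _).2, smul_eq_mul, mul_one]
    rw [← trace_sum, ← Finset.sum_mul, sum_vecMulVec_orthonormalBasis, one_mul]
  · intro n Γ hΓ
    let V : Fin d → Matrix (Fin n × Fin d) (Fin n) ℂ := fun k =>
      Matrix.of fun p j => if p.1 = j then (e k).ofLp p.2 else 0
    let A : Fin d → Matrix (Fin n) (Fin n) ℂ := fun k => (V k)ᴴ * Γ * V k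
    have hA : ∀ k, (A k).PosSemidef := fun k => hΓ.1.conjTranspose_mul_mul_same (V k)
    have hA' : ∀ k i j, A k i j =
        (vecMulVec (e k).ofLp (star (e k).ofLp) * Matrix.of fun a b => Γ (i, a) (j, b)).trace := by
      intro k i j
      simp only [A, V, Matrix.mul_apply, Matrix.trace, Matrix.diag, vecMulVec_apply,
        conjTranspose_apply, Matrix.of_apply, Fintype.sum_prod_type, Pi.star_apply]
      simp only [apply_ite star, star_zero, ite_mul, zero_mul, mul_ite, mul_zero,
        Finset.sum_ite_irrel, Finset.sum_const_zero, Finset.sum_ite_eq', Finset.mem_univ, if_true]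
      refine Finset.sum_congr rfl fun b _ => ?_
      rw [Finset.sum_mul]
      exact Finset.sum_congr rfl fun a _ => by ring
    have hsum : ∑ k, (A k).trace = 1 := by
      rw [← hΓ.2]
      rw [Matrix.trace, Fintype.sum_prod_type]
      simp only [Matrix.trace.eq_1 (A _), Matrix.diag, hA']
      rw [Finset.sum_comm]
      refine Finset.sum_congr rfl fun i _ => ?_
      rw [← trace_sum, ← Finset.sum_mul, sum_vecMulVec_orthonormalBasis, one_mul]
      rfl
    have hre : ∀ k, (((A k).trace.re : ℝ) : ℂ) = (A k).trace := fun k => by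
      have := (Complex.le_def.1 (hA k).trace_nonneg).2
      apply Complex.ext <;> simp_all
    have hpos : ∀ k, 0 ≤ (A k).trace.re := fun k =>
      (Complex.le_def.1 (hA k).trace_nonneg).1
    have hid : idTensor (Fin n) Φ Γ = ∑ k, A k ⊗ₖ R k := by
      ext p q
      simp [idTensor, hΦ, Matrix.sum_apply, hA']
    have hn : Nonempty (Fin n) := by
      by_contra h
      have := hΓ.2
      rw [not_nonempty_iff] at h
      simp [Matrix.trace] at this
    obtain ⟨i₀⟩ := hn
    -- An arbitrary state, standing in for `A k / Tr (A k)` when the weight vanishes.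
    let D : Matrix (Fin n) (Fin n) ℂ := vecMulVec (Pi.single i₀ 1) (star (Pi.single i₀ 1))
    have hD : IsDensityMatrix D := by
      refine ⟨posSemidef_vecMulVec_self_star _, ?_⟩
      simp [D, Matrix.trace, vecMulVec_apply, Pi.single_apply]
    let B : Fin d → Matrix (Fin n) (Fin n) ℂ := fun k =>
      if (A k).trace = 0 then D else ((A k).trace.re⁻¹ : ℝ) • A k
    have hB : ∀ k, IsDensityMatrix (B k) := by
      intro k
      by_cases h : (A k).trace = 0
      · simpa [B, h] using hD
      · simp only [B, h, if_false]
        refine ⟨(hA k).smul (inv_nonneg.2 (hpos k)), ?_⟩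
        rw [trace_smul, Complex.real_smul, Complex.ofReal_inv, hre, inv_mul_cancel₀ h]
    have hAB : ∀ k, A k = (A k).trace.re • B k := by
      intro k
      by_cases h : (A k).trace = 0
      · simp [(hA k).trace_eq_zero_iff.1 h]
      · simp only [B, h, if_false]
        rw [smul_smul, mul_inv_cancel₀, one_smul]
        intro h'
        exact h (by rw [← hre, h', Complex.ofReal_zero])
    refine mem_convexHull_of_exists_fintype (fun k => (A k).trace.re) (fun k => B k ⊗ₖ R k) hpos
      ?_ (fun k => ⟨_, _, hB k, hR k, rfl⟩) ?_
    · simpa using congrArg Complex.re hsum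
    · rw [hid]
      refine Finset.sum_congr rfl fun k _ => ?_
      conv_rhs => rw [hAB k]
      rw [smul_kronecker]

/-- The Holevo form of an entanglement-breaking trace-preserving map. -/
theorem exists_measurePrepare_of_mem_EBT {d : ℕ} [NeZero d]
    {Φ : Matrix (Fin d) (Fin d) ℂ →ₗ[ℂ] Matrix (Fin d) (Fin d) ℂ} (hΦ : Φ ∈ EBT d) :
    ∃ (ι : Type) (_ : Fintype ι) (F R : ι → Matrix (Fin d) (Fin d) ℂ),
      (∀ k, (F k).PosSemidef) ∧ (∀ k, IsDensityMatrix (R k)) ∧ ∑ k, F k = 1 ∧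
      Φ = ∑ k, measurePrepare (Fin d) (F k) (R k) := by
  have hd : (d : ℂ) ≠ 0 := NeZero.ne _
  let ω : Fin d × Fin d → ℂ := fun p => if p.1 = p.2 then 1 else 0
  let Γ : Matrix (Fin d × Fin d) (Fin d × Fin d) ℂ := ((d : ℝ)⁻¹) • vecMulVec ω (star ω)
  have hΓ : IsDensityMatrix Γ := by
    refine ⟨(posSemidef_vecMulVec_self_star ω).smul (by positivity), ?_⟩
    simp [Γ, ω, Matrix.trace, vecMulVec_apply, Fintype.sum_prod_type, hd]
  obtain ⟨ι, _, w, P, hw, hw1, hP, hsum⟩ :=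
    mem_convexHull_iff_exists_fintype.1 (hΦ.2 d Γ hΓ)
  choose A R hA hR hAR using hP
  -- Block `(i, j)` of `Γ` is `d⁻¹ E_ij`, so `Φ(E_ij) = d ∑ w_k (A_k)_ij R_k`, and `(A_k)_ij =
  -- Tr(A_kᵀ E_ij)`.
  let F : ι → Matrix (Fin d) (Fin d) ℂ := fun k => ((d : ℝ) * w k) • (A k)ᵀ
  have hform : Φ = ∑ k, measurePrepare (Fin d) (F k) (R k) := by
    refine Matrix.ext_linearMap _ fun i j => ?_
    ext a b
    have h := congrFun (congrFun hsum (i, a)) (j, b)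
    have hblock : (Matrix.of fun a b => Γ (i, a) (j, b)) =
        ((d : ℂ)⁻¹) • Matrix.single i j (1 : ℂ) := by
      ext a b
      by_cases h1 : i = a <;> by_cases h2 : j = b <;>
        simp [Γ, ω, vecMulVec_apply, h1, h2]
    simp only [idTensor, Matrix.of_apply, hblock, map_smul, Matrix.smul_apply, smul_eq_mul] at h
    rw [eq_inv_mul_iff_mul_eq₀ hd] at h
    simp [← h, Matrix.sum_apply, hAR, F, Finset.mul_sum, trace_mul_single, mul_assoc]
  refine ⟨ι, inferInstance, F, R, fun k => (hA k).1.transpose.smul (by have := hw k; positivity),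
    hR, ?_, hform⟩
  have htr : ∀ ρ, ((∑ k, F k) * ρ).trace = ρ.trace := by
    intro ρ
    rw [← hΦ.1 ρ, hform]
    simp [Finset.sum_mul, trace_sum, trace_smul, (hR _).2]
  refine Matrix.ext_iff_trace_mul_right.2 fun ρ => ?_
  rw [htr, one_mul]

/-! ### The Bloch ball -/

/-- The Pauli matrices. -/
def pauli : Fin 3 → Matrix (Fin 2) (Fin 2) ℂ :=
  ![!![0, 1; 1, 0], !![0, -Complex.I; Complex.I, 0], !![1, 0; 0, -1]]

/-- The Hermitian matrix of trace one with Bloch vector `r`. -/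
noncomputable def bloch (r : EuclideanSpace ℝ (Fin 3)) : Matrix (Fin 2) (Fin 2) ℂ :=
  (1 / 2 : ℝ) • (1 + ∑ j, r j • pauli j)

theorem bloch_eq (r : EuclideanSpace ℝ (Fin 3)) :
    bloch r = !![(1 + (r 2 : ℂ)) / 2, ((r 0 : ℂ) - (r 1 : ℂ) * Complex.I) / 2;
      ((r 0 : ℂ) + (r 1 : ℂ) * Complex.I) / 2, (1 - (r 2 : ℂ)) / 2] := by
  ext i j
  fin_cases i <;> fin_cases j <;>
    simp [bloch, pauli, Fin.sum_univ_three] <;> ring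

theorem trace_bloch (r : EuclideanSpace ℝ (Fin 3)) : (bloch r).trace = 1 := by
  rw [bloch_eq, trace_fin_two_of]; ring

theorem isHermitian_bloch (r : EuclideanSpace ℝ (Fin 3)) : (bloch r).IsHermitian := by
  rw [bloch_eq]
  ext i j
  fin_cases i <;> fin_cases j <;> simp [sub_eq_add_neg]

theorem det_bloch (r : EuclideanSpace ℝ (Fin 3)) :
    (bloch r).det = (((1 - ‖r‖ ^ 2) / 4 : ℝ) : ℂ) := by
  rw [bloch_eq, det_fin_two_of, EuclideanSpace.norm_sq_eq, Fin.sum_univ_three]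
  simp only [Real.norm_eq_abs, sq_abs]
  push_cast
  ring_nf
  rw [Complex.I_sq]
  ring

/-- The eigenvalues have sum 1 and product `(1 - ‖r‖²)/4`; since the sum is positive, both are
nonnegative exactly when the product is. -/
theorem isDensityMatrix_bloch_iff {r : EuclideanSpace ℝ (Fin 3)} :
    IsDensityMatrix (bloch r) ↔ ‖r‖ ≤ 1 := by
  have hH := isHermitian_bloch r
  have hs : hH.eigenvalues 0 + hH.eigenvalues 1 = 1 := by
    have := hH.trace_eq_sum_eigenvalues
    rw [trace_bloch, Fin.sum_univ_two] at this
    have := congrArg Complex.re this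
    simpa [eq_comm] using this
  have hp : hH.eigenvalues 0 * hH.eigenvalues 1 = (1 - ‖r‖ ^ 2) / 4 := by
    have := hH.det_eq_prod_eigenvalues
    rw [det_bloch, Fin.prod_univ_two] at this
    exact Complex.ofReal_injective ((Complex.ofReal_mul _ _).trans this.symm)
  have hr := norm_nonneg r
  rw [IsDensityMatrix, and_iff_left (trace_bloch r), hH.posSemidef_iff_eigenvalues_nonneg,
    Pi.le_def, Fin.forall_fin_two]
  simp only [Pi.zero_apply]
  constructor
  · rintro ⟨h0, h1⟩
    have := mul_nonneg h0 h1
    nlinarith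
  · intro h
    have : 0 ≤ hH.eigenvalues 0 * hH.eigenvalues 1 := by rw [hp]; nlinarith
    constructor <;> by_contra! hneg <;> nlinarith

theorem exists_bloch_eq {R : Matrix (Fin 2) (Fin 2) ℂ} (hR : IsDensityMatrix R) :
    ∃ r : EuclideanSpace ℝ (Fin 3), ‖r‖ ≤ 1 ∧ bloch r = R := by
  have hH := hR.1.isHermitian
  let r : EuclideanSpace ℝ (Fin 3) := !₂[2 * (R 1 0).re, 2 * (R 1 0).im, 2 * (R 0 0).re - 1]
  have h00 := congrArg Complex.im (hH.apply 0 0)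
  have h01 := hH.apply 0 1
  have htr := hR.2
  rw [trace_fin_two] at htr
  have h11 : R 1 1 = 1 - R 0 0 := by rw [← htr]; ring
  have hb : bloch r = R := by
    rw [bloch_eq]
    ext i j
    fin_cases i <;> fin_cases j <;> apply Complex.ext <;> simp [r, h11, ← h01] <;>
      first | done | (simp at h00; linarith)
  exact ⟨r, isDensityMatrix_bloch_iff.1 (hb ▸ hR), hb⟩

/-! ### The norm inequality for resolutions of the identity -/

/-- If `v(P)` and `v(1 - P)` have lengths adding up to at most `c` for every rank-one projection
`P` of `ℂ²`, then the values of `v` on any resolution of the identity have total length at most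
`c`. -/
theorem sum_norm_le_of_projections {E : Type*} [NormedAddCommGroup E] [InnerProductSpace ℝ E]
    (v : Matrix (Fin 2) (Fin 2) ℂ →ₗ[ℝ] E) {c : ℝ}
    (hc : ∀ z : EuclideanSpace ℂ (Fin 2), ‖z‖ = 1 →
      ‖v (vecMulVec z.ofLp (star z.ofLp))‖ + ‖v (1 - vecMulVec z.ofLp (star z.ofLp))‖ ≤ c)
    {ι : Type*} [Fintype ι] {F : ι → Matrix (Fin 2) (Fin 2) ℂ} (hF : ∀ k, (F k).PosSemidef)
    (hF1 : ∑ k, F k = 1) : ∑ k, ‖v (F k)‖ ≤ c := by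
  have hc0 : 0 ≤ c := (by positivity : (0 : ℝ) ≤ _).trans
    (hc (EuclideanSpace.single 0 1) (by simp))
  -- Passing to `b > c` makes `b` positive, so that it can be cancelled at the end.
  refine le_of_forall_gt_imp_ge_of_dense fun b hb => ?_
  have hb0 : 0 < b := hc0.trans_lt hb
  -- `v(P)` lies in an ellipsoid with foci `0` and `v 1`. Squaring `‖v(P) - v 1‖ ≤ b - ‖v(P)‖`
  -- cancels `‖v(P)‖²` and leaves a right side that is linear in `P` once the constant is multiplied
  -- by `Tr P = 1`. The bound therefore scales and adds up to all positive semidefinite matrices.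
  have hunit : ∀ z : EuclideanSpace ℂ (Fin 2), ‖z‖ = 1 →
      2 * b * ‖v (vecMulVec z.ofLp (star z.ofLp))‖ ≤
        b ^ 2 - ‖v 1‖ ^ 2 + 2 * ⟪v (vecMulVec z.ofLp (star z.ofLp)), v 1⟫_ℝ := by
    intro z hz
    have h := (hc z hz).trans hb.le
    rw [map_sub, norm_sub_rev] at h
    have h2 := norm_sub_sq_real (v (vecMulVec z.ofLp (star z.ofLp))) (v 1)
    have h3 := norm_nonneg (v (vecMulVec z.ofLp (star z.ofLp)) - v 1)
    nlinarith
  have hrank : ∀ z : EuclideanSpace ℂ (Fin 2),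
      2 * b * ‖v (vecMulVec z.ofLp (star z.ofLp))‖ ≤
        (vecMulVec z.ofLp (star z.ofLp)).trace.re * (b ^ 2 - ‖v 1‖ ^ 2) +
          2 * ⟪v (vecMulVec z.ofLp (star z.ofLp)), v 1⟫_ℝ := by
    intro z
    rcases eq_or_ne z 0 with rfl | hz
    · simp
    have hz' : 0 < ‖z‖ := norm_pos_iff.2 hz
    let u : EuclideanSpace ℂ (Fin 2) := ((‖z‖⁻¹ : ℝ) : ℂ) • z
    have hu : ‖u‖ = 1 := by simp [u, norm_smul, hz'.ne']
    have hzu : vecMulVec z.ofLp (star z.ofLp) = (‖z‖ ^ 2) • vecMulVec u.ofLp (star u.ofLp) := by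
      ext i j
      have : (‖z‖ : ℂ) ≠ 0 := by exact_mod_cast hz'.ne'
      simp [u, vecMulVec_apply]
      field_simp
    have htr : (vecMulVec u.ofLp (star u.ofLp)).trace.re = 1 := by
      have h := EuclideanSpace.norm_sq_eq u
      rw [hu] at h
      simp only [Matrix.trace, Matrix.diag, vecMulVec_apply, Complex.re_sum, Pi.star_apply]
      rw [← one_pow 2, h]
      refine Finset.sum_congr rfl fun i _ => ?_
      rw [← Complex.normSq_eq_norm_sq, Complex.normSq_apply]
      simp
    rw [hzu, map_smul, norm_smul, inner_smul_left, trace_smul, Complex.smul_re, htr]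
    have := mul_le_mul_of_nonneg_left (hunit u hu) (sq_nonneg ‖z‖)
    simp only [norm_pow, norm_norm, smul_eq_mul, conj_trivial]
    linarith
  have hpsd : ∀ k, 2 * b * ‖v (F k)‖ ≤
      (F k).trace.re * (b ^ 2 - ‖v 1‖ ^ 2) + 2 * ⟪v (F k), v 1⟫_ℝ := by
    intro k
    obtain ⟨m, z, hz⟩ := posSemidef_iff_eq_sum_vecMulVec.1 (hF k)
    rw [hz, map_sum, trace_sum, Complex.re_sum, sum_inner, Finset.sum_mul, Finset.mul_sum,
      ← Finset.sum_add_distrib]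
    refine (mul_le_mul_of_nonneg_left (norm_sum_le _ _) (by positivity)).trans ?_
    rw [Finset.mul_sum]
    exact Finset.sum_le_sum fun i _ => hrank (WithLp.toLp 2 (z i))
  have hall := Finset.sum_le_sum fun k (_ : k ∈ Finset.univ) => hpsd k
  rw [← Finset.mul_sum, Finset.sum_add_distrib, ← Finset.sum_mul, ← Complex.re_sum, ← trace_sum,
    ← Finset.mul_sum, ← sum_inner, ← map_sum, hF1, real_inner_self_eq_norm_sq, trace_one] at hall
  simp only [Fintype.card_fin, Nat.cast_ofNat, Complex.re_ofNat] at hall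
  -- As `Tr 1 = 2`, the `‖v 1‖²` terms cancel, leaving `2b ∑ ‖v(F_k)‖ ≤ 2b²`.
  nlinarith

/-! ### Two-outcome maps and separation -/

/-- The two-outcome map measuring `|z⟩⟨z|` and preparing states with Bloch vectors `r` and `s`. -/
noncomputable def twoOutcome (p : EuclideanSpace ℂ (Fin 2) × EuclideanSpace ℝ (Fin 3) ×
    EuclideanSpace ℝ (Fin 3)) : Matrix (Fin 2) (Fin 2) ℂ →ₗ[ℂ] Matrix (Fin 2) (Fin 2) ℂ :=
  measurePrepare (Fin 2) (vecMulVec p.1.ofLp (star p.1.ofLp)) (bloch p.2.1) +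
    measurePrepare (Fin 2) (1 - vecMulVec p.1.ofLp (star p.1.ofLp)) (bloch p.2.2)

/-- The parameters for which `twoOutcome` is a classical-quantum map. -/
def twoOutcomeParams : Set (EuclideanSpace ℂ (Fin 2) × EuclideanSpace ℝ (Fin 3) ×
    EuclideanSpace ℝ (Fin 3)) :=
  Metric.sphere 0 1 ×ˢ Metric.closedBall 0 1 ×ˢ Metric.closedBall 0 1

theorem isCompact_twoOutcomeParams : IsCompact twoOutcomeParams :=
  (isCompact_sphere _ _).prod ((isCompact_closedBall _ _).prod (isCompact_closedBall _ _))

theorem twoOutcome_mem_CQ {p} (hp : p ∈ twoOutcomeParams) : twoOutcome p ∈ CQ 2 := by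
  obtain ⟨z, r, s⟩ := p
  obtain ⟨hz, hr, hs⟩ := hp
  simp only [mem_sphere_iff_norm, mem_closedBall_iff_norm, sub_zero] at hz hr hs
  have hz' : Orthonormal ℂ (({0} : Set (Fin 2)).domRestrict fun _ => z) := by
    refine ⟨fun _ => hz, fun i j hij => (hij (Subsingleton.elim _ _)).elim⟩
  obtain ⟨e, he⟩ := hz'.exists_orthonormalBasis_extension_of_card_eq (by simp)
  have he0 : e 0 = z := he 0 rfl
  have he1 : vecMulVec (e 1).ofLp (star (e 1).ofLp) = 1 - vecMulVec z.ofLp (star z.ofLp) := by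
    rw [← sum_vecMulVec_orthonormalBasis e, Fin.sum_univ_two, he0, add_sub_cancel_left]
  refine ⟨e, ![bloch r, bloch s], ?_, fun ρ => ?_⟩
  · rw [Fin.forall_fin_two]
    exact ⟨isDensityMatrix_bloch_iff.2 hr, isDensityMatrix_bloch_iff.2 hs⟩
  · rw [Fin.sum_univ_two, he1, he0]
    rfl

/-- The coordinates of a linear map on matrices. -/
def coords : (Matrix (Fin 2) (Fin 2) ℂ →ₗ[ℂ] Matrix (Fin 2) (Fin 2) ℂ) →ₗ[ℝ]
    (Fin 2 → Fin 2 → Fin 2 → Fin 2 → ℂ) where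
  toFun Φ := fun i j a b => Φ (Matrix.single i j 1) a b
  map_add' _ _ := rfl
  map_smul' _ _ := rfl

theorem coords_injective : Function.Injective coords := by
  intro Φ Ψ h
  refine Matrix.ext_linearMap _ fun i j => ?_
  ext a b
  exact congrFun (congrFun (congrFun (congrFun h i) j) a) b

theorem continuous_coords_twoOutcome : Continuous fun p => coords (twoOutcome p) := by
  refine continuous_pi fun i => continuous_pi fun j => continuous_pi fun a =>
    continuous_pi fun b => ?_
  change Continuous fun p => twoOutcome p (Matrix.single i j 1) a b
  simp only [twoOutcome, LinearMap.add_apply, measurePrepare_apply, Matrix.add_apply,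
    Matrix.smul_apply, smul_eq_mul, Matrix.trace, Matrix.diag,
    Matrix.mul_apply, vecMulVec_apply, bloch, Pi.star_apply, Matrix.sum_apply]
  fun_prop

/-- A real-linear functional on linear maps is at most as large on an entanglement-breaking
trace-preserving qubit map as on some two-outcome classical-quantum map. -/
theorem exists_twoOutcome_ge {Φ} (hΦ : Φ ∈ EBT 2)
    (f : (Matrix (Fin 2) (Fin 2) ℂ →ₗ[ℂ] Matrix (Fin 2) (Fin 2) ℂ) →ₗ[ℝ] ℝ) :
    ∃ p ∈ twoOutcomeParams, f Φ ≤ f (twoOutcome p) := by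
  obtain ⟨ι, _, F, R, hF, hR, hF1, rfl⟩ := exists_measurePrepare_of_mem_EBT hΦ
  let v : Matrix (Fin 2) (Fin 2) ℂ →ₗ[ℝ] EuclideanSpace ℝ (Fin 3) :=
    { toFun := fun F => WithLp.toLp 2 fun j => f (measurePrepare (Fin 2) F (pauli j))
      map_add' := fun F G => by ext j; simp
      map_smul' := fun c F => by
        ext j
        simp only [RingHom.id_apply, PiLp.smul_apply, smul_eq_mul]
        rw [← Complex.coe_smul, map_smul, LinearMap.smul_apply, Complex.coe_smul, map_smul,
          smul_eq_mul] }
  let t : Matrix (Fin 2) (Fin 2) ℂ → ℝ := fun F => f (measurePrepare (Fin 2) F 1)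
  have hbloch : ∀ G r, f (measurePrepare (Fin 2) G (bloch r)) = (t G + ⟪v G, r⟫_ℝ) / 2 := by
    intro G r
    have : bloch r = ((1 / 2 : ℝ) : ℂ) • (1 + ∑ j, (r j : ℂ) • pauli j) := by
      simp only [bloch, Complex.coe_smul]
    have hreal : ∀ (c : ℝ) (Ψ : Matrix (Fin 2) (Fin 2) ℂ →ₗ[ℂ] Matrix (Fin 2) (Fin 2) ℂ),
        (c : ℂ) • Ψ = c • Ψ := fun _ _ => rfl
    have hsum : measurePrepare (Fin 2) G (∑ j, (r j : ℂ) • pauli j) =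
        ∑ j, r j • measurePrepare (Fin 2) G (pauli j) := by
      rw [map_sum]
      exact Finset.sum_congr rfl fun j _ => by rw [map_smul, hreal]
    rw [this, map_smul, hreal, map_smul, map_add, map_add, hsum, map_sum,
      PiLp.inner_apply]
    simp [t, v]
    ring
  obtain ⟨z, hz, hmax⟩ := (isCompact_sphere (0 : EuclideanSpace ℂ (Fin 2)) 1).exists_isMaxOn
    (NormedSpace.sphere_nonempty.2 zero_le_one)
    (f := fun z => ‖v (vecMulVec z.ofLp (star z.ofLp))‖ +
      ‖v (1 - vecMulVec z.ofLp (star z.ofLp))‖) (by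
        have hv : Continuous v := v.continuous_of_finiteDimensional
        have hP : Continuous fun z : EuclideanSpace ℂ (Fin 2) =>
            vecMulVec z.ofLp (star z.ofLp) := by
          refine continuous_matrix fun i j => ?_
          simp only [vecMulVec_apply, Pi.star_apply]
          fun_prop
        fun_prop)
  have hbound := sum_norm_le_of_projections v
    (fun x hx => hmax (mem_sphere_zero_iff_norm.2 hx)) hF hF1
  have hdir : ∀ x : EuclideanSpace ℝ (Fin 3), ∃ r, ‖r‖ ≤ 1 ∧ ⟪x, r⟫_ℝ = ‖x‖ := by
    intro x
    rcases eq_or_ne x 0 with rfl | hx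
    · exact ⟨0, by simp, by simp⟩
    have hx' : ‖x‖ ≠ 0 := norm_ne_zero_iff.2 hx
    refine ⟨‖x‖⁻¹ • x, by simp [norm_smul, hx'], ?_⟩
    rw [inner_smul_right, real_inner_self_eq_norm_sq]
    field_simp
  obtain ⟨r, hr, hr'⟩ := hdir (v (vecMulVec z.ofLp (star z.ofLp)))
  obtain ⟨s, hs, hs'⟩ := hdir (v (1 - vecMulVec z.ofLp (star z.ofLp)))
  refine ⟨(z, r, s), ⟨hz, by simpa using hr, by simpa using hs⟩, ?_⟩
  -- Both maps have the same `t`-part, so only the `v`-parts need comparing.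
  have ht : t (vecMulVec z.ofLp (star z.ofLp)) + t (1 - vecMulVec z.ofLp (star z.ofLp)) = t 1 := by
    simp only [t]
    rw [← map_add, ← LinearMap.add_apply, ← map_add, add_sub_cancel]
  have ht' : ∑ k, t (F k) = t 1 := by
    simp only [t]
    rw [← map_sum, ← LinearMap.sum_apply, ← map_sum, hF1]
  simp only [twoOutcome, map_add]
  rw [hbloch, hbloch, hr', hs', map_sum]
  have hk : ∀ k, f (measurePrepare (Fin 2) (F k) (R k)) ≤ (t (F k) + ‖v (F k)‖) / 2 := by
    intro k
    obtain ⟨x, hx, hxR⟩ := exists_bloch_eq (hR k)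
    rw [← hxR, hbloch]
    have := real_inner_le_norm (v (F k)) x
    have := mul_le_of_le_one_right (norm_nonneg (v (F k))) hx
    linarith
  refine (Finset.sum_le_sum fun k _ => hk k).trans ?_
  rw [← Finset.sum_div, Finset.sum_add_distrib, ht']
  linarith

theorem EBT_two_subset_convexHull_CQ : EBT 2 ⊆ convexHull ℝ (CQ 2) := by
  intro Φ hΦ
  -- The two-outcome maps form a compact family, so their hull is closed and a point outside it can
  -- be strictly separated, contradicting `exists_twoOutcome_ge`.
  suffices h : coords Φ ∈ convexHull ℝ ((fun p => coords (twoOutcome p)) '' twoOutcomeParams) by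
    have himg : (fun p => coords (twoOutcome p)) '' twoOutcomeParams =
        coords '' (twoOutcome '' twoOutcomeParams) := (Set.image_image _ _ _).symm
    rw [himg, ← LinearMap.image_convexHull] at h
    obtain ⟨Ψ, hΨ, hΨΦ⟩ := h
    rw [← coords_injective hΨΦ]
    refine convexHull_mono ?_ hΨ
    rintro _ ⟨p, hp, rfl⟩
    exact twoOutcome_mem_CQ hp
  by_contra h
  have hcpt := isCompact_convexHull
    (isCompact_twoOutcomeParams.image continuous_coords_twoOutcome)
  obtain ⟨f, u, hf, hu⟩ := geometric_hahn_banach_closed_point (convex_convexHull ℝ _)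
    hcpt.isClosed h
  obtain ⟨p, hp, hle⟩ := exists_twoOutcome_ge hΦ (f.toLinearMap ∘ₗ coords)
  have := hf _ (subset_convexHull ℝ _ ⟨p, hp, rfl⟩)
  exact absurd (hu.trans_le hle) (not_lt.2 this.le)

end Qubit

theorem mainTheorem1 :
    Set.extremePoints ℝ (Qubit.EBT 2) ⊆ Qubit.CQ 2 ∧
    Qubit.EBT 2 = convexHull ℝ (Qubit.CQ 2) := by
  have h : Qubit.EBT 2 = convexHull ℝ (Qubit.CQ 2) :=
    Set.Subset.antisymm Qubit.EBT_two_subset_convexHull_CQ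
      (convexHull_min (Qubit.CQ_subset_EBT 2) (Qubit.convex_EBT 2))
  exact ⟨h ▸ extremePoints_convexHull_subset, h⟩
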